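/- Consider a network that is a finite rooted tree. The root is the source, held at a constant potential; the leaves other than the root are the sinks, all held at one common lower constant potential. Each edge $e$ has a resistance $k_e\ge 0$, and a flow $Q\ge 0$ through it, directed away from the source, costs a potential drop $k_eQ^n$, where $n\ge 1$ is a fixed real number. Flow is conserved at all inner nodes other than the source. Each terminal edge (the edge entering a sink) carries a continuous control valve, which can add at any time any resistance in $[0,\infty]$ to that edge ($0$: fully open; $\infty$: closed, no flow). An operation of duration $\tau$ is a time-dependent setting of the valves on $[0,\tau)$ together with equilibrium flows and potentials for that setting at each time; the quantity delivered to a sink is the time integral of its inflow, which is required to be integrable. Let each sink $s$ have a demand $D_s\ge 0$, not all zero, and suppose that the path from the source to each sink with $D_s>0$ contains an edge of positive resistance. Let $t_{cv}$ be the centrally optimal time, i.e. the minimum of the durations of all operations that deliver exactly $D_s$ to every sink $s$. In a selfish operation each sink keeps its valve fully open until its own demand is met and closed from then on, and the operation ends as soon as all demands are met; let $t_{self}$ be its duration. Then the minimum $t_{cv}$ is attained and positive, a selfish operation exists, and for every selfish operation the price of anarchy $t_{self}/t_{cv}$ satisfies $$1\;\le\;\frac{t_{self}}{t_{cv}}\;\le\;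 m^{\,1-1/n},$$ where $m$ is the maximum depth of the network, i.e. the largest number of edges on a path from the source to a node. -/

import Mathlib

open scoped ENNReal

/-- A sink (demand node) of a rooted tree: a leaf other than the root. -/
def TreeSink (T : RootedTree) : Type _ := {v : T // v ≠ ⊥ ∧ IsMax v}

/-- The node of the tree at which the sink sits. -/
def TreeSink.node {T : RootedTree} (s : TreeSink T) : T := s.1

open Classical in
/-- The depth of a node: the number of edges on the path from the root to `v`. An edge is
identified with its lower end point, so these edges are the non-root nodes `u ≤ v`. -/
noncomputable def nodeDepth {T : RootedTree} [Fintype T] (v : T) : ℕ :=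
  (Finset.univ.filter fun u : T => u ≠ ⊥ ∧ u ≤ v).card

/-- The maximum depth of a finite rooted tree. -/
noncomputable def treeDepth (T : RootedTree) [Fintype T] : ℕ :=
  Finset.univ.sup fun v : T => nodeDepth v

/-- A branched potential flow network on the rooted tree `T`. The root `⊥` is the source, the
other leaves are the sinks. For `v ≠ ⊥` the edge from the parent `Order.pred v` to `v` has
resistance `k v` (the value `k ⊥` plays no role), and a flow `q` through it costs a potential
drop `k v * q ^ n`. -/
structure BranchedNetwork (T : RootedTree) where
  /-- The resistances of the edges. -/
  k : T → ℝ
  k_nonneg : ∀ v, 0 ≤ k v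
  /-- The exponent of the potential loss law. -/
  n : ℝ
  one_le_n : 1 ≤ n
  /-- The constant potential of the source. -/
  sourceHead : ℝ
  /-- The common constant potential of the sinks. -/
  sinkHead : ℝ
  sinkHead_lt_sourceHead : sinkHead < sourceHead

namespace BranchedNetwork

variable {T : RootedTree} [Fintype T]

open Classical in
/-- `N.IsState r Q h`: under the valve setting `r` the flow rates `Q` and potentials `h` are in
equilibrium. Here `r s` is the resistance which the control valve adds to the terminal edge of the
sink `s`: `0` is a fully open valve, `∞` a closed one. `Q v` is the flow rate through the edge
that enters `v`, directed away from the source, and `Q ⊥` is the outflow of the source. -/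
structure IsState (N : BranchedNetwork T) (r : TreeSink T → ℝ≥0∞) (Q h : T → ℝ) : Prop where
  flow_nonneg : ∀ v, 0 ≤ Q v
  /-- Flow is conserved at every node that is not a sink. -/
  balance : ∀ v : T, ¬ (v ≠ ⊥ ∧ IsMax v) → Q v = ∑ u : T with v ⋖ u, Q u
  head_source : h ⊥ = N.sourceHead
  head_sink : ∀ s : TreeSink T, h s.node = N.sinkHead
  /-- Potential loss along an edge without a valve. -/
  loss_inner : ∀ v : T, v ≠ ⊥ → ¬ IsMax v → h (Order.pred v) - h v = N.k v * Q v ^ N.n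
  /-- Potential loss along a terminal edge whose valve is (partially) open. -/
  loss_terminal : ∀ s : TreeSink T, r s ≠ ∞ →
    h (Order.pred s.node) - h s.node = (N.k s.node + (r s).toReal) * Q s.node ^ N.n
  /-- Nothing passes a closed valve. -/
  closed : ∀ s : TreeSink T, r s = ∞ → Q s.node = 0

/-- An operation of the network with continuous control valves during the time interval `[0, τ)`:
a time-dependent valve setting, with the flow rates and potentials that it produces. -/
structure Operation (N : BranchedNetwork T) (τ : ℝ) where
  valve : ℝ → TreeSink T → ℝ≥0∞
  flow : ℝ → T → ℝ
  head : ℝ → T → ℝ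
  duration_nonneg : 0 ≤ τ
  steady : ∀ t ∈ Set.Ico 0 τ, N.IsState (valve t) (flow t) (head t)
  integrable : ∀ s : TreeSink T,
    IntervalIntegrable (fun t => flow t s.node) MeasureTheory.volume 0 τ

variable {N : BranchedNetwork T} {τ : ℝ}

/-- The quantity delivered to the sink `s` up to time `t`. -/
noncomputable def Operation.delivered (O : N.Operation τ) (s : TreeSink T) (t : ℝ) : ℝ :=
  ∫ x in (0 : ℝ)..t, O.flow x s.node

/-- The operation delivers to every sink exactly its demand. -/
def Operation.Meets (O : N.Operation τ) (D : TreeSink T → ℝ) : Prop :=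
  ∀ s, O.delivered s τ = D s

open Classical in
/-- The selfish operation for the demands `D`: each sink keeps its valve fully open until its own
demand is met, and closed from then on; the operation ends as soon as all demands are met. -/
structure Operation.IsSelfish (O : N.Operation τ) (D : TreeSink T → ℝ) : Prop where
  valve_eq : ∀ t ∈ Set.Ico 0 τ, ∀ s, O.valve t s = if O.delivered s t < D s then 0 else ∞
  busy : ∀ t ∈ Set.Ico 0 τ, ∃ s, O.delivered s t < D s
  meets : O.Meets D

/-- The durations of all operations that meet the demands `D`. -/
def operationTimes (N : BranchedNetwork T) (D : TreeSink T → ℝ) : Set ℝ :=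
  {τ | ∃ O : N.Operation τ, O.Meets D}

/-- The durations of the selfish operations for the demands `D`. -/
def selfishTimes (N : BranchedNetwork T) (D : TreeSink T → ℝ) : Set ℝ :=
  {τ | ∃ O : N.Operation τ, O.IsSelfish D}

/-- The centrally optimal operation time. -/
noncomputable def optimalTime (N : BranchedNetwork T) (D : TreeSink T → ℝ) : ℝ :=
  sInf (N.operationTimes D)

end BranchedNetwork

/-! By conservation each edge flow is the sum of the sink flows beyond it (`IsState.flow_eq`), so
its time integral is the demand `edgeFlow D` beyond that edge, whatever the operation. Let `H` be
the available potential difference and `W` the largest path loss that the flows `edgeFlow D` would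
cause at a sink. The optimal time `t` is given by `H * t ^ n = W`: by convexity of `q ^ n` the
time-averaged flow obeys the potential limit (`Operation.Meets.pathLoss_le`), and conversely the
constant flow `D / t` is realised by valves that absorb the surplus potential
(`mem_operationTimes_of_pathLoss_le`).

In a selfish operation of duration `τ` some sink is open throughout, so the loss `∑ k * Q ^ n` on
its path is always `H`. Since the `ℓⁿ` norm is at most the `ℓ¹` norm, `H ^ (1/n) ≤ ∑ k ^ (1/n) * Q`,
which is linear in `Q`. Integration replaces `Q` by `edgeFlow D`, and the power mean inequality on
at most `m` edges gives `H * τ ^ n ≤ m ^ (n-1) * W` (`Operation.IsSelfish.headDiff_mul_le`).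

Selfish operations are concatenations of constant equilibria, each obtained by minimising `content`
(`exists_equilibrium`). -/

noncomputable instance (T : RootedTree) [Fintype T] : Fintype (TreeSink T) :=
  Fintype.ofInjective (fun s : TreeSink T => s.1) Subtype.val_injective

theorem TreeSink.node_ne_bot {T : RootedTree} (s : TreeSink T) : s.node ≠ ⊥ := s.2.1

theorem TreeSink.isMax_node {T : RootedTree} (s : TreeSink T) : IsMax s.node := s.2.2

/-! ### Order facts for rooted trees -/

namespace RootedTree

variable {T : RootedTree}

theorem pred_lt {v : T} (hv : v ≠ ⊥) : Order.pred v < v :=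
  Order.pred_lt_of_not_isMin fun h => hv h.eq_bot

theorem le_iff_eq_or_le_pred {u v : T} (hv : v ≠ ⊥) : u ≤ v ↔ u = v ∨ u ≤ Order.pred v :=
  ⟨fun h => h.eq_or_lt.imp id Order.le_pred_of_lt,
    fun h => h.elim le_of_eq fun h => h.trans (pred_lt hv).le⟩

theorem not_isMax_pred {v : T} (hv : v ≠ ⊥) : ¬ IsMax (Order.pred v) :=
  (pred_lt hv).not_isMax

theorem covBy_unique {v u w a : T} (hu : v ⋖ u) (hw : v ⋖ w) (hua : u ≤ a) (hwa : w ≤ a) :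
    u = w := by
  rcases le_total_of_directed hwa hua with h | h
  · exact h.eq_of_not_lt fun h => hw.2 hu.1 h
  · exact (h.eq_of_not_lt fun h => hu.2 hw.1 h).symm

end RootedTree

/-! ### Edge flows, path losses and equilibrium states -/

namespace BranchedNetwork

/-- The available potential difference. -/
noncomputable def headDiff {T : RootedTree} (N : BranchedNetwork T) : ℝ := N.sourceHead - N.sinkHead

theorem headDiff_pos {T : RootedTree} (N : BranchedNetwork T) : 0 < N.headDiff := sub_pos.2 N.sinkHead_lt_sourceHead

theorem n_pos {T : RootedTree} (N : BranchedNetwork T) : 0 < N.n := one_pos.trans_le N.one_le_n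

variable {T : RootedTree} [Fintype T]

open Classical in
/-- The flow rate through the edge entering `v` when the sinks receive the flow rates `x`. -/
noncomputable def edgeFlow (x : TreeSink T → ℝ) (v : T) : ℝ :=
  ∑ s : TreeSink T with v ≤ s.node, x s

open Classical in
/-- The potential loss on the path from the source to `v`, not counting the valves. -/
noncomputable def pathLoss (N : BranchedNetwork T) (Q : T → ℝ) (v : T) : ℝ :=
  ∑ u : T with u ≠ ⊥ ∧ u ≤ v, N.k u * Q u ^ N.n

variable (N : BranchedNetwork T)

theorem edgeFlow_node (x : TreeSink T → ℝ) (s : TreeSink T) : edgeFlow x s.node = x s := by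
  classical
  rw [edgeFlow, Finset.sum_eq_single_of_mem s (by simp)]
  intro s' hs' hne
  exact absurd (Subtype.ext (s.isMax_node.eq_of_le (Finset.mem_filter.1 hs').2).symm) hne

theorem edgeFlow_nonneg {x : TreeSink T → ℝ} (hx : ∀ s, 0 ≤ x s) (v : T) : 0 ≤ edgeFlow x v :=
  Finset.sum_nonneg fun s _ => hx s

theorem le_edgeFlow {x : TreeSink T → ℝ} (hx : ∀ s, 0 ≤ x s) {v : T} {s : TreeSink T}
    (h : v ≤ s.node) : x s ≤ edgeFlow x v := by
  classical
  exact Finset.single_le_sum (fun s _ => hx s) (Finset.mem_filter.2 ⟨Finset.mem_univ s, h⟩)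

theorem edgeFlow_div (x : TreeSink T → ℝ) (t : ℝ) (v : T) :
    edgeFlow (fun s => x s / t) v = edgeFlow x v / t :=
  (Finset.sum_div _ _ _).symm

open Classical in
-- Each sink beyond `v` lies beyond exactly one child of `v`, because the nodes below a sink form a
-- chain.
theorem edgeFlow_balance (x : TreeSink T → ℝ) {v : T} (hv : ¬ (v ≠ ⊥ ∧ IsMax v)) :
    edgeFlow x v = ∑ u : T with v ⋖ u, edgeFlow x u := by
  unfold edgeFlow
  rw [← Finset.sum_biUnion]
  · refine Finset.sum_congr ?_ fun _ _ => rfl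
    ext s
    simp only [Finset.mem_filter, Finset.mem_univ, true_and, Finset.mem_biUnion]
    constructor
    · intro h
      have hlt : v < s.node := lt_of_le_of_ne h fun e => hv (e ▸ s.2)
      exact exists_covBy_le_of_lt hlt
    · rintro ⟨u, hu, hus⟩
      exact hu.le.trans hus
  · intro u hu w hw hne
    refine Finset.disjoint_left.2 fun s hs hs' => hne ?_
    simp only [Finset.coe_filter, Finset.mem_univ, true_and, Set.mem_ofPred_eq,
      Finset.mem_filter] at hu hw hs hs'
    exact RootedTree.covBy_unique hu hw hs hs'

theorem IsState.flow_eq {N : BranchedNetwork T} {r : TreeSink T → ℝ≥0∞} {Q h : T → ℝ}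
    (hS : N.IsState r Q h) (v : T) : Q v = edgeFlow (fun s => Q s.node) v := by
  classical
  induction v using WellFoundedGT.induction with
  | ind v ih =>
    by_cases hv : v ≠ ⊥ ∧ IsMax v
    · exact (edgeFlow_node (fun s => Q s.node) (⟨v, hv⟩ : TreeSink T)).symm
    · rw [edgeFlow_balance _ hv, hS.balance v hv]
      exact Finset.sum_congr rfl fun u hu => ih u (Finset.mem_filter.1 hu).2.lt

variable {N}

theorem pathLoss_bot (Q : T → ℝ) : N.pathLoss Q ⊥ = 0 := by
  classical
  refine Finset.sum_eq_zero fun u hu => ?_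
  have := (Finset.mem_filter.1 hu).2
  exact absurd (le_bot_iff.1 this.2) this.1

theorem pathLoss_of_ne_bot (Q : T → ℝ) {v : T} (hv : v ≠ ⊥) :
    N.pathLoss Q v = N.pathLoss Q (Order.pred v) + N.k v * Q v ^ N.n := by
  classical
  unfold pathLoss
  have : (Finset.univ.filter fun u : T => u ≠ ⊥ ∧ u ≤ v) =
      insert v (Finset.univ.filter fun u : T => u ≠ ⊥ ∧ u ≤ Order.pred v) := by
    ext u
    simp only [Finset.mem_filter, Finset.mem_univ, true_and, Finset.mem_insert,
      RootedTree.le_iff_eq_or_le_pred hv]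
    constructor
    · rintro ⟨h, h' | h'⟩
      · exact .inl h'
      · exact .inr ⟨h, h'⟩
    · rintro (rfl | h)
      · exact ⟨hv, .inl rfl⟩
      · exact ⟨h.1, .inr h.2⟩
  rw [this, Finset.sum_insert, add_comm]
  simp [(RootedTree.pred_lt hv).not_ge]

theorem pathLoss_mono {Q : T → ℝ} (hQ : ∀ v, 0 ≤ Q v) : Monotone (N.pathLoss Q) := by
  classical
  intro v w hvw
  refine Finset.sum_le_sum_of_subset_of_nonneg (fun u hu => ?_) fun u _ _ =>
    mul_nonneg (N.k_nonneg u) (Real.rpow_nonneg (hQ u) _)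
  simp only [Finset.mem_filter, Finset.mem_univ, true_and] at hu ⊢
  exact ⟨hu.1, hu.2.trans hvw⟩

theorem edge_loss_le_pathLoss {Q : T → ℝ} (hQ : ∀ v, 0 ≤ Q v) {u v : T} (hu : u ≠ ⊥)
    (huv : u ≤ v) : N.k u * Q u ^ N.n ≤ N.pathLoss Q v := by
  classical
  exact Finset.single_le_sum (f := fun u => N.k u * Q u ^ N.n)
    (fun u _ => mul_nonneg (N.k_nonneg u) (Real.rpow_nonneg (hQ u) _))
    (Finset.mem_filter.2 ⟨Finset.mem_univ u, hu, huv⟩)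

theorem pathLoss_div {Q : T → ℝ} (hQ : ∀ v, 0 ≤ Q v) {t : ℝ} (ht : 0 ≤ t) (v : T) :
    N.pathLoss (fun u => Q u / t) v = N.pathLoss Q v / t ^ N.n := by
  unfold pathLoss
  rw [Finset.sum_div]
  exact Finset.sum_congr rfl fun u _ => by rw [Real.div_rpow (hQ u) ht, mul_div_assoc]

/-- If the path loss to every sink with a positive flow is at most `H`, so is the loss to every
node. -/
theorem pathLoss_le_of_pos {x : TreeSink T → ℝ} (hx : ∀ s, 0 ≤ x s) {H : ℝ} (hH : 0 ≤ H)
    (h : ∀ s, 0 < x s → N.pathLoss (edgeFlow x) s.node ≤ H) (v : T) :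
    N.pathLoss (edgeFlow x) v ≤ H := by
  classical
  induction v using WellFoundedLT.induction with
  | ind v ih =>
    by_cases hv : v = ⊥
    · rw [hv, pathLoss_bot]
      exact hH
    -- An edge without flow adds no loss to that of the parent; an edge with flow leads to a sink
    -- with positive flow, whose loss dominates.
    · by_cases hQ : edgeFlow x v = 0
      · rw [pathLoss_of_ne_bot _ hv, hQ, Real.zero_rpow N.n_pos.ne', mul_zero, add_zero]
        exact ih _ (RootedTree.pred_lt hv)
      · obtain ⟨s, hs, hxs⟩ := Finset.exists_ne_zero_of_sum_ne_zero hQ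
        exact (pathLoss_mono (edgeFlow_nonneg hx) (Finset.mem_filter.1 hs).2).trans
          (h s ((hx s).lt_of_ne' hxs))

theorem IsState.head_eq {r : TreeSink T → ℝ≥0∞} {Q h : T → ℝ}
    (hS : N.IsState r Q h) {v : T} (hv : ¬ (v ≠ ⊥ ∧ IsMax v)) :
    h v = N.sourceHead - N.pathLoss Q v := by
  induction v using WellFoundedLT.induction with
  | ind v ih =>
    by_cases hb : v = ⊥
    · rw [hb, pathLoss_bot, hS.head_source, sub_zero]
    · have h1 := hS.loss_inner v hb fun hm => hv ⟨hb, hm⟩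
      have h2 := ih _ (RootedTree.pred_lt hb) fun hm => RootedTree.not_isMax_pred hb hm.2
      rw [pathLoss_of_ne_bot _ hb]
      linarith

theorem IsState.pathLoss_add {r : TreeSink T → ℝ≥0∞} {Q h : T → ℝ}
    (hS : N.IsState r Q h) {s : TreeSink T} (hs : r s ≠ ∞) :
    N.pathLoss Q s.node + (r s).toReal * Q s.node ^ N.n = N.headDiff := by
  have h1 := hS.loss_terminal s hs
  have h2 := hS.head_eq fun hm => RootedTree.not_isMax_pred s.node_ne_bot hm.2
  rw [hS.head_sink] at h1
  rw [pathLoss_of_ne_bot _ s.node_ne_bot, headDiff]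
  linarith

theorem IsState.pathLoss_le {r : TreeSink T → ℝ≥0∞} {Q h : T → ℝ}
    (hS : N.IsState r Q h) (v : T) : N.pathLoss Q v ≤ N.headDiff := by
  have hQ : Q = edgeFlow (fun s => Q s.node) := funext hS.flow_eq
  rw [hQ]
  refine pathLoss_le_of_pos (fun s => hS.flow_nonneg _) N.headDiff_pos.le (fun s hs => ?_) v
  rw [← hQ]
  have h1 := hS.pathLoss_add (s := s) fun h => hs.ne' (hS.closed s h)
  have : 0 ≤ (r s).toReal * Q s.node ^ N.n :=
    mul_nonneg ENNReal.toReal_nonneg (Real.rpow_nonneg hs.le _)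
  linarith

open Classical in
/-- The potentials belonging to the edge flows `Q`. -/
noncomputable def headOf (N : BranchedNetwork T) (Q : T → ℝ) (v : T) : ℝ :=
  if v ≠ ⊥ ∧ IsMax v then N.sinkHead else N.sourceHead - N.pathLoss Q v

/-- Sink flows determine edge flows and potentials, so only one equation per sink is left to check.
-/
theorem isState_of_sinkFlow {r : TreeSink T → ℝ≥0∞} {x : TreeSink T → ℝ} (hx : ∀ s, 0 ≤ x s)
    (hclosed : ∀ s, r s = ∞ → x s = 0)
    (hopen : ∀ s, r s ≠ ∞ →
      N.pathLoss (edgeFlow x) s.node + (r s).toReal * x s ^ N.n = N.headDiff) :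
    N.IsState r (edgeFlow x) (N.headOf (edgeFlow x)) where
  flow_nonneg := edgeFlow_nonneg hx
  balance v hv := by
    convert edgeFlow_balance x hv
  head_source := by simp [headOf, pathLoss_bot]
  head_sink s := if_pos s.2
  loss_inner v hv hm := by
    rw [headOf, headOf, if_neg fun h => RootedTree.not_isMax_pred hv h.2, if_neg fun h => hm h.2,
      pathLoss_of_ne_bot _ hv]
    ring
  loss_terminal s hs := by
    have h1 := hopen s hs
    rw [pathLoss_of_ne_bot _ s.node_ne_bot, headDiff] at h1
    rw [headOf, headOf, if_neg fun h => RootedTree.not_isMax_pred s.node_ne_bot h.2,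
      if_pos (show s.node ≠ ⊥ ∧ IsMax s.node from s.2), edgeFlow_node]
    rw [edgeFlow_node] at h1
    linarith
  closed s hs := by rw [edgeFlow_node, hclosed s hs]

/-! ### Existence of equilibria by a variational principle -/

theorem deriv_signs_of_isMinOn_Icc {g : ℝ → ℝ} {a M d : ℝ} (ha : a ∈ Set.Icc 0 M)
    (hmin : IsMinOn g (Set.Icc 0 M) a) (hd : HasDerivAt g d a) :
    (a < M → 0 ≤ d) ∧ (0 < a → d ≤ 0) := by
  have key : ∀ y ∈ Set.Icc 0 M, 0 ≤ d * (y - a) := by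
    intro y hy
    have := hmin.localize.hasFDerivWithinAt_nonneg hd.hasDerivWithinAt.hasFDerivWithinAt
      (sub_mem_posTangentConeAt_of_segment_subset ((convex_Icc 0 M).segment_subset ha hy))
    simpa [mul_comm] using this
  refine ⟨fun h => ?_, fun h => ?_⟩
  · exact nonneg_of_mul_nonneg_left (key M ⟨ha.1.trans ha.2, le_rfl⟩) (sub_pos.2 h)
  · have := key 0 ⟨le_rfl, ha.1.trans ha.2⟩
    nlinarith

open Classical in
theorem edgeFlow_update (x : TreeSink T → ℝ) (s : TreeSink T) (t : ℝ) (v : T) :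
    edgeFlow (Function.update x s t) v = edgeFlow x v + if v ≤ s.node then t - x s else 0 := by
  unfold edgeFlow
  rw [Finset.sum_filter, Finset.sum_filter, ← sub_eq_iff_eq_add', ← Finset.sum_sub_distrib,
    Finset.sum_eq_single s]
  · by_cases h : v ≤ s.node <;> simp [h]
  · intro s' _ hs'
    simp [Function.update_of_ne hs']
  · simp

open Classical in
/-- The convex potential whose minimisers are the equilibria. -/
noncomputable def content (N : BranchedNetwork T) (x : TreeSink T → ℝ) : ℝ :=
  (∑ v : T with v ≠ ⊥, N.k v * (edgeFlow x v ^ (N.n + 1) / (N.n + 1))) - N.headDiff * ∑ s, x s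

theorem continuous_content : Continuous N.content := by
  unfold content edgeFlow
  have := N.n_pos
  refine Continuous.sub (continuous_finsetSum _ fun v _ => ?_) (by fun_prop)
  refine continuous_const.mul (Continuous.div_const ?_ _)
  exact Continuous.rpow_const (by fun_prop) fun _ => .inr (by linarith)

open Classical in
-- Only edges on the path to `s` feel `x s`, each contributing `k * Q ^ n`. Stationarity in `x s` is
-- thus the equation of a fully open valve.
theorem hasDerivAt_content_update (x : TreeSink T → ℝ) (s : TreeSink T) :
    HasDerivAt (fun t => N.content (Function.update x s t))
      (N.pathLoss (edgeFlow x) s.node - N.headDiff) (x s) := by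
  have hn := N.n_pos
  unfold content
  refine HasDerivAt.sub ?_ ?_
  · have hloss : N.pathLoss (edgeFlow x) s.node = ∑ v : T with v ≠ ⊥,
        if v ≤ s.node then N.k v * edgeFlow x v ^ N.n else 0 := by
      rw [pathLoss, ← Finset.sum_filter, Finset.filter_filter]
    rw [hloss]
    refine HasDerivAt.fun_sum fun v _ => ?_
    simp only [edgeFlow_update]
    by_cases hv : v ≤ s.node
    · simp only [hv, if_true]
      have h1 : HasDerivAt (fun t => edgeFlow x v + (t - x s)) 1 (x s) :=
        ((hasDerivAt_id _).sub_const _).const_add _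
      have h2 := ((h1.rpow_const (p := N.n + 1) (.inr (by linarith))).div_const
        (N.n + 1)).const_mul (N.k v)
      refine h2.congr_deriv ?_
      simp only [sub_self, add_zero, add_sub_cancel_right]
      field_simp
    · simp only [hv, if_false]
      exact hasDerivAt_const _ _
  · have : (fun t => ∑ s', Function.update x s t s') = fun t => (∑ s', x s') + (t - x s) := by
      funext t
      rw [← sub_eq_iff_eq_add', ← Finset.sum_sub_distrib, Finset.sum_eq_single s]
      · simp
      · intro s' _ hs'
        simp [Function.update_of_ne hs']
      · simp
    have h1 : HasDerivAt (fun t => ∑ s', Function.update x s t s') 1 (x s) := by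
      rw [this]
      exact ((hasDerivAt_id _).sub_const _).const_add _
    simpa using h1.const_mul N.headDiff

theorem exists_large_flow (N : BranchedNetwork T) :
    ∃ M : ℝ, 0 < M ∧ ∀ v, 0 < N.k v → N.headDiff < N.k v * M ^ N.n := by
  have hH := N.headDiff_pos
  have h0 : ∀ v, 0 ≤ N.headDiff / N.k v := fun v => div_nonneg hH.le (N.k_nonneg v)
  have hS : 0 ≤ ∑ v, N.headDiff / N.k v := Finset.sum_nonneg fun v _ => h0 v
  -- The summand `1` gives `M ≤ M ^ n`; edges of zero resistance contribute `H / 0 = 0`.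
  refine ⟨1 + ∑ v, N.headDiff / N.k v, by linarith, fun v hv => ?_⟩
  have h1 : N.headDiff / N.k v ≤ ∑ v, N.headDiff / N.k v :=
    Finset.single_le_sum (f := fun v => N.headDiff / N.k v) (fun v _ => h0 v) (Finset.mem_univ v)
  have h2 := Real.self_le_rpow_of_one_le (x := 1 + ∑ v, N.headDiff / N.k v) (by linarith)
    N.one_le_n
  rw [← div_lt_iff₀' hv]
  linarith

/-- If every open sink is separated from the source by a positive resistance, there is an
equilibrium in which the valves in `A` are fully open and the others are closed. -/
theorem exists_equilibrium (N : BranchedNetwork T) (A : Set (TreeSink T))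
    (hA : ∀ s ∈ A, ∃ v : T, v ≠ ⊥ ∧ v ≤ s.node ∧ 0 < N.k v) :
    ∃ x : TreeSink T → ℝ, (∀ s, 0 ≤ x s) ∧ (∀ s ∉ A, x s = 0) ∧
      ∀ s ∈ A, N.pathLoss (edgeFlow x) s.node = N.headDiff := by
  classical
  obtain ⟨M, hM, hkM⟩ := N.exists_large_flow
  -- The cap `M` provides compactness; it turns out to be inactive at the minimiser.
  let B : Set (TreeSink T → ℝ) := Set.pi Set.univ fun s => Set.Icc 0 (if s ∈ A then M else 0)
  have hBc : IsCompact B := isCompact_univ_pi fun s => isCompact_Icc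
  have hBne : B.Nonempty := ⟨0, fun s _ => ⟨le_rfl, by split_ifs <;> simp [hM.le]⟩⟩
  obtain ⟨x, hxB, hmin⟩ := hBc.exists_isMinOn hBne N.continuous_content.continuousOn
  have hx0 : ∀ s, 0 ≤ x s := fun s => (hxB s trivial).1
  have hxA : ∀ s ∉ A, x s = 0 := fun s hs =>
    le_antisymm (by simpa [hs] using (hxB s trivial).2) (hx0 s)
  have hxM : ∀ s ∈ A, x s ≤ M := fun s hs => by simpa [hs] using (hxB s trivial).2
  have hsigns : ∀ s ∈ A, (x s < M → N.headDiff ≤ N.pathLoss (edgeFlow x) s.node) ∧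
      (0 < x s → N.pathLoss (edgeFlow x) s.node ≤ N.headDiff) := by
    intro s hs
    have := deriv_signs_of_isMinOn_Icc (M := M) ⟨hx0 s, hxM s hs⟩ (fun t ht => ?_)
      (N.hasDerivAt_content_update x s)
    · simpa using this
    · have : Function.update x s t ∈ B := by
        intro s' _
        by_cases h : s' = s
        · subst h
          simpa [hs] using ht
        · rw [Function.update_of_ne h]
          exact hxB s' trivial
      simpa using hmin this
  have hle := pathLoss_le_of_pos (N := N) hx0 N.headDiff_pos.le fun s hs =>
    (hsigns s (by_contra fun h => hs.ne' (hxA s h))).2 hs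
  refine ⟨x, hx0, hxA, fun s hs => le_antisymm (hle _) ((hsigns s hs).1 ?_)⟩
  -- A flow of at least `M` through the resistant edge would already lose more than the available
  -- potential.
  by_contra! hMs
  obtain ⟨v, hv, hvs, hkv⟩ := hA s hs
  have h1 := edge_loss_le_pathLoss (N := N) (edgeFlow_nonneg hx0) hv hvs
  have h2 : M ^ N.n ≤ edgeFlow x v ^ N.n :=
    Real.rpow_le_rpow hM.le (hMs.trans (le_edgeFlow hx0 hvs)) N.n_pos.le
  have h3 := mul_le_mul_of_nonneg_left h2 hkv.le
  linarith [hkM v hkv, hle s.node]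

end BranchedNetwork

/-! ### Power inequalities and sums of integrable functions -/

/-- Bernoulli's inequality at `x / a`. This supporting line stands in for Jensen's inequality and
spares integrability of `Q ^ n`. -/
theorem Real.exists_rpow_tangent {a p : ℝ} (ha : 0 ≤ a) (hp : 1 ≤ p) :
    ∃ c : ℝ, ∀ x, 0 ≤ x → a ^ p + c * (x - a) ≤ x ^ p := by
  rcases ha.eq_or_lt with rfl | ha
  · refine ⟨0, fun x hx => ?_⟩
    rw [Real.zero_rpow (by linarith), zero_mul, add_zero]
    exact Real.rpow_nonneg hx _
  · refine ⟨a ^ p * p / a, fun x hx => ?_⟩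
    have h1 := one_add_mul_self_le_rpow_one_add (s := x / a - 1) (by
      have := div_nonneg hx ha.le
      linarith) hp
    rw [add_sub_cancel, Real.div_rpow hx ha.le, le_div_iff₀ (Real.rpow_pos_of_pos ha p)] at h1
    refine le_trans (le_of_eq ?_) h1
    field_simp

theorem Real.sum_rpow_le_rpow_sum {ι : Type*} (s : Finset ι) {f : ι → ℝ} {p : ℝ}
    (hf : ∀ i ∈ s, 0 ≤ f i) (hp : 1 ≤ p) : ∑ i ∈ s, f i ^ p ≤ (∑ i ∈ s, f i) ^ p := by
  classical
  induction s using Finset.induction_on with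
  | empty => simp [Real.zero_rpow (show p ≠ 0 by linarith)]
  | insert a s ha ih =>
    rw [Finset.sum_insert ha, Finset.sum_insert ha]
    have h1 := ih fun i hi => hf i (Finset.mem_insert_of_mem hi)
    have h2 : 0 ≤ ∑ i ∈ s, f i := Finset.sum_nonneg fun i hi => hf i (Finset.mem_insert_of_mem hi)
    have h3 : 0 ≤ f a := hf a (Finset.mem_insert_self a s)
    refine (add_le_add le_rfl h1).trans ?_
    lift f a to NNReal using h3 with y
    lift ∑ i ∈ s, f i to NNReal using h2 with z
    exact_mod_cast NNReal.add_rpow_le_rpow_add y z hp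

theorem intervalIntegrable_sum_apply {ι : Type*} (s : Finset ι) {f : ι → ℝ → ℝ} {a b : ℝ}
    (h : ∀ i ∈ s, IntervalIntegrable (f i) MeasureTheory.volume a b) :
    IntervalIntegrable (fun t => ∑ i ∈ s, f i t) MeasureTheory.volume a b :=
  ⟨MeasureTheory.integrable_finsetSum s fun i hi => (h i hi).1,
    MeasureTheory.integrable_finsetSum s fun i hi => (h i hi).2⟩

/-! ### The optimal time: averaging and constant flows -/

namespace BranchedNetwork

variable {T : RootedTree} [Fintype T] {N : BranchedNetwork T} {τ : ℝ} {D : TreeSink T → ℝ}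

theorem pathLoss_demand_pos (hD : ∀ s, 0 ≤ D s) {s : TreeSink T} (hs : 0 < D s)
    (hk : ∃ v : T, v ≠ ⊥ ∧ v ≤ s.node ∧ 0 < N.k v) : 0 < N.pathLoss (edgeFlow D) s.node := by
  obtain ⟨v, hv, hvs, hkv⟩ := hk
  exact (mul_pos hkv (Real.rpow_pos_of_pos (hs.trans_le (le_edgeFlow hD hvs)) _)).trans_le
    (edge_loss_le_pathLoss (edgeFlow_nonneg hD) hv hvs)

theorem Operation.intervalIntegrable_edgeFlow (O : N.Operation τ) (v : T) :
    IntervalIntegrable (fun t => edgeFlow (fun s => O.flow t s.node) v)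
      MeasureTheory.volume 0 τ :=
  intervalIntegrable_sum_apply _ fun s _ => O.integrable s

theorem Operation.Meets.integral_edgeFlow {O : N.Operation τ} (hO : O.Meets D) (v : T) :
    ∫ t in (0 : ℝ)..τ, edgeFlow (fun s => O.flow t s.node) v = edgeFlow D v := by
  classical
  unfold edgeFlow
  rw [intervalIntegral.integral_finsetSum fun s _ => O.integrable s]
  exact Finset.sum_congr rfl fun s _ => hO s

theorem Operation.Meets.duration_pos {O : N.Operation τ} (hO : O.Meets D)
    (hD0 : ∃ s, 0 < D s) : 0 < τ := by
  refine O.duration_nonneg.lt_of_ne fun h => ?_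
  subst h
  obtain ⟨s, hs⟩ := hD0
  rw [← hO s, Operation.delivered, intervalIntegral.integral_same] at hs
  exact hs.false

/-- By convexity, the average flow of an operation respects the available potential difference. -/
theorem Operation.Meets.pathLoss_le {O : N.Operation τ} (hO : O.Meets D)
    (hD : ∀ s, 0 ≤ D s) (hτ : 0 < τ) (v : T) :
    N.pathLoss (edgeFlow D) v ≤ N.headDiff * τ ^ N.n := by
  classical
  rw [← div_le_iff₀ (Real.rpow_pos_of_pos hτ _), ← pathLoss_div (edgeFlow_nonneg hD) hτ.le]
  choose c hc using fun u : T =>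
    Real.exists_rpow_tangent (div_nonneg (edgeFlow_nonneg hD u) hτ.le) N.one_le_n
  let q : ℝ → T → ℝ := fun t u => edgeFlow (fun s => O.flow t s.node) u
  let g : ℝ → ℝ := fun t => ∑ u : T with u ≠ ⊥ ∧ u ≤ v,
    N.k u * ((edgeFlow D u / τ) ^ N.n + c u * (q t u - edgeFlow D u / τ))
  have hint : ∀ u, IntervalIntegrable
      (fun t => N.k u * ((edgeFlow D u / τ) ^ N.n + c u * (q t u - edgeFlow D u / τ)))
      MeasureTheory.volume 0 τ := fun u =>
    (intervalIntegrable_const.add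
      (((O.intervalIntegrable_edgeFlow u).sub intervalIntegrable_const).const_mul _)).const_mul _
  have hg : IntervalIntegrable g MeasureTheory.volume 0 τ :=
    intervalIntegrable_sum_apply _ fun u _ => hint u
  have hgle : ∀ t ∈ Set.Ioo 0 τ, g t ≤ N.headDiff := by
    intro t ht
    have hS := O.steady t ⟨ht.1.le, ht.2⟩
    refine le_trans (Finset.sum_le_sum fun u _ => ?_) (hS.pathLoss_le v)
    refine mul_le_mul_of_nonneg_left ?_ (N.k_nonneg u)
    rw [hS.flow_eq u]
    exact hc u _ (edgeFlow_nonneg (fun s => hS.flow_nonneg _) u)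
  have h1 := intervalIntegral.integral_mono_on_of_le_Ioo hτ.le hg intervalIntegrable_const hgle
  -- The tangents are taken at the time averages, so their linear terms integrate to zero.
  have h2 : ∫ t in (0 : ℝ)..τ, g t = τ * N.pathLoss (fun u => edgeFlow D u / τ) v := by
    rw [intervalIntegral.integral_finsetSum fun u _ => hint u, pathLoss, Finset.mul_sum]
    refine Finset.sum_congr rfl fun u _ => ?_
    rw [intervalIntegral.integral_const_mul, intervalIntegral.integral_add
        intervalIntegrable_const
        (((O.intervalIntegrable_edgeFlow u).sub intervalIntegrable_const).const_mul _),
      intervalIntegral.integral_const_mul, intervalIntegral.integral_sub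
        (O.intervalIntegrable_edgeFlow u) intervalIntegrable_const, hO.integral_edgeFlow u]
    simp only [intervalIntegral.integral_const, sub_zero, smul_eq_mul]
    field_simp
    ring
  rw [h2, intervalIntegral.integral_const, sub_zero, smul_eq_mul] at h1
  exact le_of_mul_le_mul_left h1 hτ

/-- A constant flow meets the demands within any time that the path losses permit. -/
theorem mem_operationTimes_of_pathLoss_le (hD : ∀ s, 0 ≤ D s) (hτ : 0 < τ)
    (h : ∀ s : TreeSink T, N.pathLoss (edgeFlow D) s.node ≤ N.headDiff * τ ^ N.n) :
    τ ∈ N.operationTimes D := by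
  classical
  let x : TreeSink T → ℝ := fun s => D s / τ
  have hx : ∀ s, 0 ≤ x s := fun s => div_nonneg (hD s) hτ.le
  have hloss : ∀ s : TreeSink T, N.pathLoss (edgeFlow x) s.node ≤ N.headDiff := by
    intro s
    have : edgeFlow x = fun v => edgeFlow D v / τ := funext (edgeFlow_div D τ)
    rw [this, pathLoss_div (edgeFlow_nonneg hD) hτ.le,
      div_le_iff₀ (Real.rpow_pos_of_pos hτ _)]
    exact h s
  -- The valve burns exactly the potential left over at its sink; sinks without flow are closed.
  let r : TreeSink T → ℝ≥0∞ := fun s => if x s = 0 then ∞ else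
    ENNReal.ofReal ((N.headDiff - N.pathLoss (edgeFlow x) s.node) / x s ^ N.n)
  have hS : N.IsState r (edgeFlow x) (N.headOf (edgeFlow x)) := by
    refine isState_of_sinkFlow hx (fun s hs => ?_) fun s hs => ?_
    · by_contra h0
      simp [r, h0] at hs
    · have h0 : x s ≠ 0 := fun h0 => hs (if_pos h0)
      have hpos := Real.rpow_pos_of_pos ((hx s).lt_of_ne' h0) N.n
      simp only [r, h0, if_false]
      rw [ENNReal.toReal_ofReal (div_nonneg (sub_nonneg.2 (hloss s)) hpos.le),
        div_mul_cancel₀ _ hpos.ne', add_sub_cancel]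
  refine ⟨⟨fun _ => r, fun _ => edgeFlow x, fun _ => N.headOf (edgeFlow x), hτ.le,
    fun _ _ => hS, fun _ => intervalIntegrable_const⟩, fun s => ?_⟩
  simp only [Operation.delivered, intervalIntegral.integral_const, sub_zero, smul_eq_mul,
    edgeFlow_node, x]
  field_simp

/-! ### Upper bound for selfish operations -/

theorem Operation.intervalIntegrable_sub (O : N.Operation τ) (s : TreeSink T) {a b : ℝ}
    (ha : a ∈ Set.Icc 0 τ) (hb : b ∈ Set.Icc 0 τ) :
    IntervalIntegrable (fun t => O.flow t s.node) MeasureTheory.volume a b := by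
  refine (O.integrable s).mono_set ?_
  rw [Set.uIcc_of_le O.duration_nonneg]
  exact Set.uIcc_subset_Icc ha hb

theorem Operation.delivered_mono (O : N.Operation τ) (s : TreeSink T) {a b : ℝ}
    (ha : 0 ≤ a) (hab : a ≤ b) (hb : b < τ) : O.delivered s a ≤ O.delivered s b := by
  have h0 : (0 : ℝ) ∈ Set.Icc 0 τ := ⟨le_rfl, O.duration_nonneg⟩
  have ha' : a ∈ Set.Icc 0 τ := ⟨ha, hab.trans hb.le⟩
  have hb' : b ∈ Set.Icc 0 τ := ⟨ha.trans hab, hb.le⟩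
  rw [← sub_nonneg, Operation.delivered, Operation.delivered,
    intervalIntegral.integral_interval_sub_left (O.intervalIntegrable_sub s h0 hb')
      (O.intervalIntegrable_sub s h0 ha')]
  exact intervalIntegral.integral_nonneg hab fun t ht =>
    (O.steady t ⟨ha.trans ht.1, ht.2.trans_lt hb⟩).flow_nonneg _

/-- In a selfish operation some sink keeps its valve fully open all the time. -/
theorem Operation.IsSelfish.exists_always_open {O : N.Operation τ} (hO : O.IsSelfish D)
    (hτ : 0 < τ) : ∃ s, ∀ t ∈ Set.Ico 0 τ, O.valve t s = 0 := by
  suffices ∃ s, ∀ t ∈ Set.Ico 0 τ, O.delivered s t < D s by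
    obtain ⟨s, hs⟩ := this
    exact ⟨s, fun t ht => by rw [hO.valve_eq t ht s, if_pos (hs t ht)]⟩
  by_contra! hcon
  choose t ht hDt using hcon
  obtain ⟨s0, -⟩ := hO.busy 0 ⟨le_rfl, hτ⟩
  -- If every sink were satisfied before `τ`, none would be busy at the latest of the chosen times.
  obtain ⟨s1, -, hs1⟩ := Finset.exists_max_image Finset.univ t ⟨s0, Finset.mem_univ _⟩
  obtain ⟨s, hs⟩ := hO.busy (t s1) (ht s1)
  exact absurd ((hDt s).trans (O.delivered_mono s (ht s).1 (hs1 s (Finset.mem_univ s)) (ht s1).2))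
    hs.not_ge

/-- For an always open sink the `n`-th root of the path loss is constant in time and bounded by a
linear form in the flows, whose integral depends on `D` alone. -/
theorem Operation.IsSelfish.headDiff_mul_le {O : N.Operation τ} (hO : O.IsSelfish D)
    (hD : ∀ s, 0 ≤ D s) (hτ : 0 < τ) : ∃ s : TreeSink T,
      N.headDiff * τ ^ N.n ≤ (treeDepth T : ℝ) ^ (N.n - 1) * N.pathLoss (edgeFlow D) s.node := by
  classical
  obtain ⟨s, hs⟩ := hO.exists_always_open hτ
  refine ⟨s, ?_⟩
  have hn := N.n_pos
  have hH := N.headDiff_pos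
  let P : Finset T := Finset.univ.filter fun u : T => u ≠ ⊥ ∧ u ≤ s.node
  -- With this weight each loss `k * q ^ n` is the pure power `(κ * q) ^ n`.
  let κ : T → ℝ := fun u => N.k u ^ (1 / N.n)
  have hκ : ∀ u, 0 ≤ κ u := fun u => Real.rpow_nonneg (N.k_nonneg u) _
  have hκn : ∀ u q, 0 ≤ q → (κ u * q) ^ N.n = N.k u * q ^ N.n := by
    intro u q hq
    rw [Real.mul_rpow (hκ u) hq, ← Real.rpow_mul (N.k_nonneg u), one_div_mul_cancel hn.ne',
      Real.rpow_one]
  let g : ℝ → ℝ := fun t => ∑ u ∈ P, κ u * edgeFlow (fun s => O.flow t s.node) u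
  have hint : ∀ u, IntervalIntegrable (fun t => κ u * edgeFlow (fun s => O.flow t s.node) u)
      MeasureTheory.volume 0 τ := fun u => (O.intervalIntegrable_edgeFlow u).const_mul _
  have hg : IntervalIntegrable g MeasureTheory.volume 0 τ :=
    intervalIntegrable_sum_apply _ fun u _ => hint u
  have hle : ∀ t ∈ Set.Ioo 0 τ, N.headDiff ^ (1 / N.n) ≤ g t := by
    intro t ht
    have ht' : t ∈ Set.Ico 0 τ := ⟨ht.1.le, ht.2⟩
    have hS := O.steady t ht'
    have hnn : ∀ u, 0 ≤ edgeFlow (fun s => O.flow t s.node) u :=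
      edgeFlow_nonneg fun s => hS.flow_nonneg _
    have h1 := hS.pathLoss_add (s := s) (by simp [hs t ht'])
    rw [hs t ht', ENNReal.toReal_zero, zero_mul, add_zero] at h1
    rw [one_div, Real.rpow_inv_le_iff_of_pos hH.le
      (Finset.sum_nonneg fun u _ => mul_nonneg (hκ u) (hnn u)) hn, ← h1]
    refine le_trans (le_of_eq (Finset.sum_congr rfl fun u _ => ?_))
      (Real.sum_rpow_le_rpow_sum P (fun u _ => mul_nonneg (hκ u) (hnn u)) N.one_le_n)
    rw [hκn u _ (hnn u), ← hS.flow_eq u]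
  have h1 := intervalIntegral.integral_mono_on_of_le_Ioo hτ.le intervalIntegrable_const hg hle
  have h2 : ∫ t in (0 : ℝ)..τ, g t = ∑ u ∈ P, κ u * edgeFlow D u := by
    rw [intervalIntegral.integral_finsetSum fun u _ => hint u]
    exact Finset.sum_congr rfl fun u _ => by
      rw [intervalIntegral.integral_const_mul, hO.meets.integral_edgeFlow u]
  rw [h2, intervalIntegral.integral_const, sub_zero, smul_eq_mul] at h1
  have hDnn := edgeFlow_nonneg hD
  have hdepth : (P.card : ℝ) ≤ treeDepth T := by
    have : nodeDepth s.node ≤ treeDepth T := Finset.le_sup (f := nodeDepth) (Finset.mem_univ _)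
    refine Nat.cast_le.2 (le_trans (le_of_eq ?_) this)
    rfl
  calc N.headDiff * τ ^ N.n = (τ * N.headDiff ^ (1 / N.n)) ^ N.n := by
        rw [Real.mul_rpow hτ.le (Real.rpow_nonneg hH.le _), ← Real.rpow_mul hH.le,
          one_div_mul_cancel hn.ne', Real.rpow_one, mul_comm]
    _ ≤ (∑ u ∈ P, κ u * edgeFlow D u) ^ N.n :=
        Real.rpow_le_rpow (mul_nonneg hτ.le (Real.rpow_nonneg hH.le _)) h1 hn.le
    _ ≤ (P.card : ℝ) ^ (N.n - 1) * ∑ u ∈ P, (κ u * edgeFlow D u) ^ N.n :=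
        Real.rpow_sum_le_const_mul_sum_rpow_of_nonneg _ N.one_le_n
          fun u _ => mul_nonneg (hκ u) (hDnn u)
    _ = (P.card : ℝ) ^ (N.n - 1) * N.pathLoss (edgeFlow D) s.node := by
        congr 1
        exact Finset.sum_congr rfl fun u _ => hκn u _ (hDnn u)
    _ ≤ (treeDepth T : ℝ) ^ (N.n - 1) * N.pathLoss (edgeFlow D) s.node := by
        refine mul_le_mul_of_nonneg_right (Real.rpow_le_rpow (Nat.cast_nonneg _) hdepth
          (sub_nonneg.2 N.one_le_n)) ?_
        rw [← pathLoss_bot (N := N) (edgeFlow D)]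
        exact pathLoss_mono hDnn bot_le

end BranchedNetwork

/-! ### Existence of selfish operations by concatenation -/

namespace BranchedNetwork

variable {T : RootedTree} [Fintype T] {N : BranchedNetwork T} {τ : ℝ} {D : TreeSink T → ℝ}

section Append

open Classical in
/-- A constant flow during `[0, t₁)`, followed by the operation `O`. -/
noncomputable def Operation.prepend (O : N.Operation τ) {r : TreeSink T → ℝ≥0∞} {Q h : T → ℝ}
    (hS : N.IsState r Q h) {t₁ : ℝ} (ht₁ : 0 ≤ t₁) : N.Operation (t₁ + τ) where
  valve t := if t < t₁ then r else O.valve (t - t₁)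
  flow t := if t < t₁ then Q else O.flow (t - t₁)
  head t := if t < t₁ then h else O.head (t - t₁)
  duration_nonneg := add_nonneg ht₁ O.duration_nonneg
  steady t ht := by
    by_cases h1 : t < t₁
    · simpa only [h1, if_true] using hS
    · simp only [h1, if_false]
      exact O.steady _ ⟨by linarith, by linarith [ht.2]⟩
  integrable s := by
    refine IntervalIntegrable.trans (b := t₁) ?_ ?_
    · refine (intervalIntegrable_const (c := Q s.node)).congr_uIoo fun t ht => ?_
      rw [Set.uIoo_of_le ht₁] at ht
      simp [ht.2]
    · have h1 := (O.integrable s).comp_sub_right t₁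
      rw [zero_add, add_comm τ] at h1
      refine h1.congr_uIoo fun t ht => ?_
      rw [Set.uIoo_of_le (by linarith [O.duration_nonneg])] at ht
      simp [ht.1.le.not_gt]

variable (O : N.Operation τ) {r : TreeSink T → ℝ≥0∞} {Q h : T → ℝ} (hS : N.IsState r Q h)
  {t₁ : ℝ} (ht₁ : 0 ≤ t₁)

theorem Operation.delivered_prepend_of_le (s : TreeSink T) {t : ℝ} (h0 : 0 ≤ t) (ht : t ≤ t₁) :
    (O.prepend hS ht₁).delivered s t = t * Q s.node := by
  rw [Operation.delivered, intervalIntegral.integral_congr_Ioo_of_le (g := fun _ => Q s.node) h0]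
  · simp
  · intro y hy
    simp [Operation.prepend, hy.2.trans_le ht]

theorem Operation.delivered_prepend_of_ge (s : TreeSink T) {t : ℝ} (h1 : t₁ ≤ t)
    (ht : t ≤ t₁ + τ) :
    (O.prepend hS ht₁).delivered s t = t₁ * Q s.node + O.delivered s (t - t₁) := by
  have hτ := O.duration_nonneg
  have e1 : (0 : ℝ) ∈ Set.Icc 0 (t₁ + τ) := ⟨le_rfl, by linarith⟩
  have e2 : t₁ ∈ Set.Icc 0 (t₁ + τ) := ⟨ht₁, by linarith⟩
  have e3 : t ∈ Set.Icc 0 (t₁ + τ) := ⟨by linarith, ht⟩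
  rw [← O.delivered_prepend_of_le hS ht₁ s ht₁ le_rfl, Operation.delivered,
    ← intervalIntegral.integral_add_adjacent_intervals
      ((O.prepend hS ht₁).intervalIntegrable_sub s e1 e2)
      ((O.prepend hS ht₁).intervalIntegrable_sub s e2 e3)]
  congr 1
  rw [Operation.delivered, ← sub_self t₁,
    ← intervalIntegral.integral_comp_sub_right (fun y => O.flow y s.node)]
  refine intervalIntegral.integral_congr_Ioo_of_le h1 fun y hy => ?_
  simp [Operation.prepend, hy.1.le.not_gt]

end Append

open Classical in
-- Induction on the number of unsatisfied sinks: hold the equilibrium with exactly these sinks open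
-- until the first of them is satisfied, then continue with the remaining demands.
theorem exists_isSelfish (hD : ∀ s, 0 ≤ D s)
    (hk : ∀ s, 0 < D s → ∃ v : T, v ≠ ⊥ ∧ v ≤ s.node ∧ 0 < N.k v) :
    ∃ τ, ∃ O : N.Operation τ, O.IsSelfish D := by
  induction hc : (Finset.univ.filter fun s => 0 < D s).card using Nat.strong_induction_on
    generalizing D with
  | _ c ih =>
  by_cases hD0 : ∃ s, 0 < D s
  swap
  · push Not at hD0
    refine ⟨0, ⟨fun _ _ => 0, fun _ _ => 0, fun _ _ => 0, le_rfl, by simp, by simp⟩,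
      by simp, by simp, fun s => ?_⟩
    simpa [Operation.delivered] using (hD s).antisymm (hD0 s)
  obtain ⟨x, hx, hxclosed, hxopen⟩ := N.exists_equilibrium {s | 0 < D s} hk
  let r : TreeSink T → ℝ≥0∞ := fun s => if 0 < D s then 0 else ∞
  have hS : N.IsState r (edgeFlow x) (N.headOf (edgeFlow x)) := by
    refine isState_of_sinkFlow hx (fun s hs => hxclosed s fun h => ?_) fun s hs => ?_
    · simp [r, show 0 < D s from h] at hs
    · have h : 0 < D s := by
        by_contra h
        exact hs (if_neg h)
      simp [r, h, hxopen s h]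
  -- Zero flow would cause no loss, whereas an open sink requires the full potential difference.
  have hxpos : (Finset.univ.filter fun s => 0 < x s).Nonempty := by
    by_contra hne
    have hzero : ∀ s, x s = 0 := fun s => (hx s).antisymm' (not_lt.1 fun h =>
      hne ⟨s, Finset.mem_filter.2 ⟨Finset.mem_univ s, h⟩⟩)
    obtain ⟨s, hs⟩ := hD0
    have h1 := hxopen s hs
    have h2 : N.pathLoss (edgeFlow x) s.node = 0 :=
      Finset.sum_eq_zero fun u _ => by
        simp [edgeFlow, hzero, Real.zero_rpow N.n_pos.ne']
    exact N.headDiff_pos.ne (h2.symm.trans h1)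
  obtain ⟨s₁, hs₁, hmin⟩ := Finset.exists_min_image _ (fun s => D s / x s) hxpos
  have hx₁ : 0 < x s₁ := (Finset.mem_filter.1 hs₁).2
  have hDx : ∀ s, 0 < x s → 0 < D s := fun s hs => by
    by_contra h
    exact hs.ne' (hxclosed s h)
  obtain ⟨t₁, ht₁⟩ : ∃ t₁, t₁ = D s₁ / x s₁ := ⟨_, rfl⟩
  have ht₁pos : 0 < t₁ := ht₁ ▸ div_pos (hDx s₁ hx₁) hx₁
  have hle : ∀ s, t₁ * x s ≤ D s := by
    intro s
    rcases (hx s).eq_or_lt with h | h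
    · rw [← h, mul_zero]
      exact hD s
    · rw [← le_div_iff₀ h, ht₁]
      exact hmin s (Finset.mem_filter.2 ⟨Finset.mem_univ s, h⟩)
  -- The set of unsatisfied sinks stays the same before `t₁`; it includes open sinks that receive no
  -- flow.
  have hlt : ∀ t, 0 ≤ t → t < t₁ → ∀ s, t * x s < D s ↔ 0 < D s := by
    intro t h0 ht s
    refine ⟨fun h => (mul_nonneg h0 (hx s)).trans_lt h, fun h => ?_⟩
    rcases (hx s).eq_or_lt with h' | h'
    · rwa [← h', mul_zero]
    · exact (mul_lt_mul_of_pos_right ht h').trans_le (hle s)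
  let D' : TreeSink T → ℝ := fun s => D s - t₁ * x s
  have hD'le : ∀ s, D' s ≤ D s := fun s => sub_le_self _ (mul_nonneg ht₁pos.le (hx s))
  obtain ⟨τ, O, hO⟩ := ih (D := D') _ (by
    rw [← hc]
    refine Finset.card_lt_card ⟨fun s hs => ?_, fun hsub => ?_⟩
    · simp only [Finset.mem_filter, Finset.mem_univ, true_and] at hs ⊢
      exact hs.trans_le (hD'le s)
    -- The minimising sink `s₁` has no demand left at `t₁`, so the count drops.
    · have h1 := (Finset.mem_filter.1
        (hsub (Finset.mem_filter.2 ⟨Finset.mem_univ s₁, hDx s₁ hx₁⟩))).2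
      simp only [D', ht₁, div_mul_cancel₀ _ hx₁.ne', sub_self] at h1
      exact h1.false) (fun s => sub_nonneg.2 (hle s))
    (fun s hs => hk s (hs.trans_le (hD'le s))) rfl
  have hbefore : ∀ t, 0 ≤ t → t < t₁ → ∀ s,
      ((O.prepend hS ht₁pos.le).delivered s t < D s ↔ 0 < D s) := by
    intro t h0 ht s
    rw [O.delivered_prepend_of_le hS ht₁pos.le s h0 ht.le, edgeFlow_node]
    exact hlt t h0 ht s
  have hafter : ∀ t, t₁ ≤ t → t ≤ t₁ + τ → ∀ s,
      ((O.prepend hS ht₁pos.le).delivered s t < D s ↔ O.delivered s (t - t₁) < D' s) := by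
    intro t h1 ht s
    rw [O.delivered_prepend_of_ge hS ht₁pos.le s h1 ht, edgeFlow_node, lt_sub_iff_add_lt']
  refine ⟨t₁ + τ, O.prepend hS ht₁pos.le, fun t ht s => ?_, fun t ht => ?_, fun s => ?_⟩
  · by_cases h : t < t₁
    · simp only [hbefore t ht.1 h s]
      simp [Operation.prepend, h, r]
    · simp only [hafter t (not_lt.1 h) ht.2.le s]
      simp only [Operation.prepend, h, if_false]
      exact hO.valve_eq _ ⟨by linarith, by linarith [ht.2]⟩ s
  · by_cases h : t < t₁
    · obtain ⟨s, hs⟩ := hD0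
      exact ⟨s, (hbefore t ht.1 h s).2 hs⟩
    · obtain ⟨s, hs⟩ := hO.busy (t - t₁) ⟨by linarith, by linarith [ht.2]⟩
      exact ⟨s, (hafter t (not_lt.1 h) ht.2.le s).2 hs⟩
  · rw [O.delivered_prepend_of_ge hS ht₁pos.le s (by linarith [O.duration_nonneg]) le_rfl,
      edgeFlow_node, add_sub_cancel_left, hO.meets s]
    simp [D']

end BranchedNetwork

/-! ### The optimal time in closed form and the price of anarchy -/

theorem mainTheorem4 (T : RootedTree) [Fintype T] (N : BranchedNetwork T)
    (D : TreeSink T → ℝ) (hD : ∀ s, 0 ≤ D s) (hD0 : ∃ s, 0 < D s)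
    (hk : ∀ s, 0 < D s → ∃ v : T, v ≠ ⊥ ∧ v ≤ s.node ∧ 0 < N.k v) :
    IsLeast (N.operationTimes D) (N.optimalTime D) ∧ 0 < N.optimalTime D ∧
    (N.selfishTimes D).Nonempty ∧
    ∀ τ ∈ N.selfishTimes D,
      1 ≤ τ / N.optimalTime D ∧
      τ / N.optimalTime D ≤ (treeDepth T : ℝ) ^ (1 - 1 / N.n) := by
  have hn := N.n_pos
  have hH := N.headDiff_pos
  obtain ⟨s₀, hs₀⟩ := hD0
  obtain ⟨s₁, -, hmax⟩ := Finset.exists_max_image Finset.univ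
    (fun s : TreeSink T => N.pathLoss (BranchedNetwork.edgeFlow D) s.node)
    ⟨s₀, Finset.mem_univ _⟩
  obtain ⟨W, hW⟩ : ∃ W, W = N.pathLoss (BranchedNetwork.edgeFlow D) s₁.node := ⟨_, rfl⟩
  simp only [Finset.mem_univ, true_imp_iff, ← hW] at hmax
  have hWpos : 0 < W :=
    (BranchedNetwork.pathLoss_demand_pos hD hs₀ (hk s₀ hs₀)).trans_le (hmax s₀)
  obtain ⟨t, ht⟩ : ∃ t, t = (W / N.headDiff) ^ (1 / N.n) := ⟨_, rfl⟩
  have htpos : 0 < t := ht ▸ Real.rpow_pos_of_pos (div_pos hWpos hH) _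
  have htn : N.headDiff * t ^ N.n = W := by
    rw [ht, ← Real.rpow_mul (div_pos hWpos hH).le, one_div_mul_cancel hn.ne', Real.rpow_one,
      mul_div_cancel₀ _ hH.ne']
  have hleast : IsLeast (N.operationTimes D) t := by
    refine ⟨BranchedNetwork.mem_operationTimes_of_pathLoss_le hD htpos fun s => htn ▸ hmax s, ?_⟩
    rintro τ ⟨O, hO⟩
    have hτ := hO.duration_pos ⟨s₀, hs₀⟩
    have h1 := hO.pathLoss_le hD hτ s₁.node
    rw [← hW, ← htn] at h1
    exact (Real.rpow_le_rpow_iff htpos.le hτ.le hn).1 (le_of_mul_le_mul_left h1 hH)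
  have hopt : N.optimalTime D = t := hleast.csInf_eq
  rw [hopt]
  refine ⟨hleast, htpos, BranchedNetwork.exists_isSelfish hD hk, ?_⟩
  rintro τ ⟨O, hO⟩
  have hτ := hO.meets.duration_pos ⟨s₀, hs₀⟩
  refine ⟨(one_le_div htpos).2 (hleast.2 ⟨O, hO.meets⟩), ?_⟩
  obtain ⟨s, hs⟩ := hO.headDiff_mul_le hD hτ
  have hm : (0 : ℝ) ≤ treeDepth T := Nat.cast_nonneg _
  -- Taking `n`-th powers turns the bound into `τ ^ n ≤ m ^ (n-1) * t ^ n`, to be compared after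
  -- multiplication by `H`.
  rw [← Real.rpow_le_rpow_iff (div_pos hτ htpos).le (Real.rpow_nonneg hm _) hn,
    Real.div_rpow hτ.le htpos.le, ← Real.rpow_mul hm,
    show (1 - 1 / N.n) * N.n = N.n - 1 by field_simp,
    div_le_iff₀ (Real.rpow_pos_of_pos htpos _)]
  refine le_of_mul_le_mul_left (hs.trans ?_) hH
  rw [mul_left_comm, htn]
  exact mul_le_mul_of_nonneg_left (hmax s) (Real.rpow_nonneg hm _)
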